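/- An ideal on $\omega=\{0,1,2,\dots\}$ is a family $\mathcal I\subseteq\mathcal P(\omega)$ that is closed under subsets and finite unions, contains all finite subsets of $\omega$, and does not contain $\omega$; put $\mathcal I^+=\mathcal P(\omega)\setminus\mathcal I$. A topological space $X$ belongs to $\mathrm{FinBW}(\mathcal I)$ if for every sequence $(x_n)_{n\in\omega}$ in $X$ there is $A\in\mathcal I^+$ such that the subsequence $(x_n)_{n\in A}$ converges in $X$. The ideal $\mathcal I$ has the FinBW property if $[0,1]\in\mathrm{FinBW}(\mathcal I)$. Theorem (ideal version of Mazurkiewicz's theorem). Let $\mathcal I$ be an ideal on $\omega$. The following conditions are equivalent. 1. $\mathcal I$ has the FinBW property. 2. For every uniformly bounded sequence $(f_n)_{n\in\omega}$ of continuous functions $f_n\colon\mathbb R\to\mathbb R$ there exist $A\in\mathcal I^+$ and a nonempty perfect set $P\subseteq\mathbb R$ (that is, a closed set without isolated points) such that the subsequence $(f_n\restriction P)_{n\in A}$ is uniformly convergent. -/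

import Mathlib

open Filter Topology

/-- The space `X` belongs to the class `FinBW(I)`: every sequence in `X` has a subsequence indexed
by an `I`-positive set (a set not in `I`) that converges in `X`. For an infinite `A ⊆ ℕ`, the
subsequence `(x n)_{n ∈ A}` converges to `p` iff `x` tends to `p` along `atTop ⊓ 𝓟 A`
(every neighbourhood of `p` contains `x n` for all but finitely many `n ∈ A`). -/
def FinBW (I : Order.Ideal (Set ℕ)) (X : Type*) [TopologicalSpace X] : Prop :=
  ∀ x : ℕ → X, ∃ A : Set ℕ, A ∉ I ∧ ∃ p : X, Tendsto x (atTop ⊓ 𝓟 A) (𝓝 p)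

/-- The ideal `I` has the FinBW property: `[0,1] ∈ FinBW(I)`. -/
def HasFinBWProperty (I : Order.Ideal (Set ℕ)) : Prop :=
  FinBW I unitInterval

/-! FinBW makes `f n` converge pointwise on ℚ to some bounded `g` along a positive set `A`. By Baire
category `g` oscillates little on a set dense in a smaller ball; iterating gives a binary tree of
balls (`exists_denseBall_tree`). For `n ≥ N i` in `A`, `f n` is near `g` at the finitely many
centres of level `i`; balls entered in step `i` are so small that `f n` barely varies on them for `n
< N i`. Indices in `[N i, N (i+1))` escape the second control unless the branch rests at step `i`:
then step `i+1` shrinks around the same centre and both bounds apply.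

Hence branches resting at even (odd) steps serve the blocks with `i` even (odd). These blocks cover
`A` up to a finite set, so one of the two families is positive (`exists_split_uniformCauchy`). Its
branches give an uncountable set, whose closure contains a perfect set. For the converse, constant
functions suffice. -/

theorem Order.Ideal.neBot_atTop_inf_principal {I : Order.Ideal (Set ℕ)}
    (hfin : ∀ F : Set ℕ, F.Finite → F ∈ I) {A : Set ℕ} (hA : A ∉ I) :
    (atTop ⊓ 𝓟 A : Filter ℕ).NeBot := by
  rw [← Nat.cofinite_eq_atTop]
  exact Set.Infinite.cofinite_inf_principal_neBot fun h => hA (hfin A h)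

/-! ### Permanence of FinBW and pointwise convergence -/

/-- `FinBW` passes to closed subspaces. -/
theorem FinBW.of_isClosedEmbedding {I : Order.Ideal (Set ℕ)}
    (hfin : ∀ F : Set ℕ, F.Finite → F ∈ I) {X Y : Type*} [TopologicalSpace X]
    [TopologicalSpace Y] {e : X → Y} (he : IsClosedEmbedding e) (h : FinBW I Y) : FinBW I X := by
  intro x
  obtain ⟨A, hA, p, hp⟩ := h (e ∘ x)
  have := Order.Ideal.neBot_atTop_inf_principal hfin hA
  obtain ⟨q, rfl⟩ : p ∈ Set.range e :=
    he.isClosed_range.mem_of_tendsto hp (Eventually.of_forall fun n => ⟨x n, rfl⟩)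
  exact ⟨A, hA, q, he.isInducing.tendsto_nhds_iff.2 hp⟩

/-- `FinBW` passes to continuous images. -/
theorem FinBW.of_surjective {I : Order.Ideal (Set ℕ)} {X Y : Type*} [TopologicalSpace X]
    [TopologicalSpace Y] {φ : X → Y} (hc : Continuous φ) (hs : Function.Surjective φ)
    (h : FinBW I X) : FinBW I Y := by
  intro y
  choose x hx using fun n => hs (y n)
  obtain ⟨A, hA, p, hp⟩ := h x
  refine ⟨A, hA, φ p, ?_⟩
  have := (hc.tendsto p).comp hp
  rwa [show φ ∘ x = y from funext hx] at this

/-- If `[0,1]` is in `FinBW(I)`, then so is every nonempty compact metrizable space. -/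
theorem HasFinBWProperty.finBW {I : Order.Ideal (Set ℕ)}
    (hfin : ∀ F : Set ℕ, F.Finite → F ∈ I) (h : HasFinBWProperty I) (X : Type*)
    [TopologicalSpace X] [TopologicalSpace.MetrizableSpace X] [CompactSpace X] [Nonempty X] :
    FinBW I X := by
  let _ : MetricSpace X := TopologicalSpace.metrizableSpaceMetric X
  -- Cantor space maps onto `X` and embeds as a closed subset of `[0,1]`.
  obtain ⟨φ, hφ, hs⟩ := exists_nat_bool_continuous_surjective_of_compact X
  refine FinBW.of_surjective hφ hs ?_
  let e : (ℕ → Bool) → unitInterval := fun z =>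
    ⟨(cantorSetHomeomorphNatToBool.symm z).1,
      cantorSet_subset_unitInterval (cantorSetHomeomorphNatToBool.symm z).2⟩
  have hec : Continuous e :=
    (continuous_subtype_val.comp cantorSetHomeomorphNatToBool.symm.continuous).subtype_mk _
  have hei : Function.Injective e := by
    intro a b hab
    apply cantorSetHomeomorphNatToBool.symm.injective
    exact Subtype.ext (congrArg (fun u : unitInterval => (u : ℝ)) hab)
  exact FinBW.of_isClosedEmbedding hfin (hec.isClosedEmbedding hei) h

/-- A uniformly bounded sequence of real functions converges pointwise on a given countable set
along some `I`-positive set of indices. -/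
theorem HasFinBWProperty.exists_tendsto_on_countable {I : Order.Ideal (Set ℕ)}
    (hfin : ∀ F : Set ℕ, F.Finite → F ∈ I) (h : HasFinBWProperty I) {α : Type*} {S : Set α}
    (hS : S.Countable) {f : ℕ → α → ℝ} {M : ℝ} (hM : ∀ n x, |f n x| ≤ M) :
    ∃ A : Set ℕ, A ∉ I ∧ ∃ g : α → ℝ, (∀ x, |g x| ≤ |M|) ∧
      ∀ x ∈ S, Tendsto (f · x) (atTop ⊓ 𝓟 A) (𝓝 (g x)) := by
  have : Countable S := hS
  have : Nonempty (Set.Icc (-|M|) |M|) := ⟨0, by simp⟩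
  obtain ⟨A, hA, p, hp⟩ := h.finBW hfin (S → Set.Icc (-|M|) |M|)
    (fun n s => ⟨f n s, abs_le.1 ((hM n s).trans (le_abs_self M))⟩)
  classical
  refine ⟨A, hA, fun x => if hx : x ∈ S then (p ⟨x, hx⟩ : ℝ) else 0, fun x => ?_, fun x hx => ?_⟩
  · by_cases hx : x ∈ S
    · simpa only [hx, dif_pos] using abs_le.2 (p ⟨x, hx⟩).2
    · simp [hx]
  · have h1 := tendsto_pi_nhds.1 hp ⟨x, hx⟩
    simp only [dif_pos hx]
    exact (continuous_subtype_val.tendsto _).comp h1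

/-! ### Small oscillation on dense pieces -/

/-- A bounded function on a set dense in a nonempty open set `V` has oscillation at most `ε` on a
subset which is dense in some nonempty open subset of `V`. -/
theorem exists_dense_piece_of_small_osc {g : ℝ → ℝ} {M : ℝ} (hg : ∀ x, |g x| ≤ M)
    {Q V : Set ℝ} (hV : IsOpen V) (hne : V.Nonempty) (hVQ : V ⊆ closure Q) {ε : ℝ} (hε : 0 < ε) :
    ∃ Q' ⊆ Q, ∃ W ⊆ V, IsOpen W ∧ W.Nonempty ∧ W ⊆ closure Q' ∧
      ∀ x ∈ Q', ∀ y ∈ Q', |g x - g y| ≤ ε := by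
  obtain ⟨t, ht, hcov⟩ := Metric.totallyBounded_iff.1 (totallyBounded_Icc (-M) M) (ε / 2)
    (by positivity)
  have : Finite t := ht
  let P : t → Set ℝ := fun a => {x ∈ Q | g x ∈ Metric.ball (a : ℝ) (ε / 2)}
  -- Adding the complement of `V` as the index `none` makes these closed sets cover ℝ, so Baire's
  -- theorem applies.
  let C : Option t → Set ℝ := fun o => o.elim Vᶜ fun a => closure (P a)
  have hC : ∀ o, IsClosed (C o)
    | none => hV.isClosed_compl
    | some a => isClosed_closure
  have hQ : Q ⊆ ⋃ a, P a := fun x hx => by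
    obtain ⟨a, ha, hxa⟩ := Set.mem_iUnion₂.1 (hcov (abs_le.1 (hg x)))
    exact Set.mem_iUnion.2 ⟨⟨a, ha⟩, hx, hxa⟩
  have hU : ⋃ o, C o = Set.univ := by
    refine Set.eq_univ_of_forall fun x => ?_
    by_cases hx : x ∈ V
    · have := closure_mono hQ (hVQ hx)
      rw [closure_iUnion_of_finite] at this
      obtain ⟨a, ha⟩ := Set.mem_iUnion.1 this
      exact Set.mem_iUnion.2 ⟨some a, ha⟩
    · exact Set.mem_iUnion.2 ⟨none, hx⟩
  obtain ⟨x, hxV, hx⟩ := (dense_iUnion_interior_of_closed hC hU).inter_open_nonempty V hV hne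
  obtain ⟨o, ho⟩ := Set.mem_iUnion.1 hx
  match o with
  | none => exact absurd hxV (interior_subset ho)
  | some a =>
    refine ⟨P a, fun x hx => hx.1, interior (closure (P a)) ∩ V, Set.inter_subset_right,
      isOpen_interior.inter hV, ⟨x, ho, hxV⟩, fun y hy => interior_subset hy.1, ?_⟩
    intro x hx y hy
    have h1 := hx.2
    have h2 := hy.2
    rw [Metric.mem_ball, Real.dist_eq] at h1 h2
    rw [abs_lt] at h1 h2
    rw [abs_le]
    constructor <;> linarith

/-- A ball around a point of a set `Q ⊆ S` in which `Q` is dense. -/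
structure DenseBall (S : Set ℝ) where
  center : ℝ
  radius : ℝ
  carrier : Set ℝ
  radius_pos : 0 < radius
  center_mem : center ∈ carrier
  carrier_subset : carrier ⊆ S
  ball_subset : Metric.ball center radius ⊆ closure carrier

namespace DenseBall

variable {S : Set ℝ}

/-- The closed ball underlying a dense ball. -/
def closedBall (v : DenseBall S) : Set ℝ := Metric.closedBall v.center v.radius

theorem center_mem_closedBall (v : DenseBall S) : v.center ∈ v.closedBall :=
  Metric.mem_closedBall_self v.radius_pos.le

theorem exists_refine_in_open {g : ℝ → ℝ} {M : ℝ} (hg : ∀ x, |g x| ≤ M) (v : DenseBall S)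
    {V : Set ℝ} (hV : IsOpen V) (hne : V.Nonempty) (hVv : V ⊆ Metric.ball v.center v.radius)
    {ε : ℝ} (hε : 0 < ε) :
    ∃ w : DenseBall S, w.closedBall ⊆ V ∧ w.carrier ⊆ v.carrier ∧
      ∀ x ∈ w.carrier, ∀ y ∈ w.carrier, |g x - g y| ≤ ε := by
  obtain ⟨Q', hQ', W, hWV, hW, hWne, hWQ, hosc⟩ :=
    exists_dense_piece_of_small_osc hg hV hne (hVv.trans v.ball_subset) hε
  obtain ⟨x, hx⟩ := hWne
  obtain ⟨c, hcW, hcQ⟩ := mem_closure_iff.1 (hWQ hx) W hW hx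
  obtain ⟨r, hr, hrW⟩ := Metric.nhds_basis_closedBall.mem_iff.1 (hW.mem_nhds hcW)
  exact ⟨⟨c, r, Q', hr, hcQ, hQ'.trans v.carrier_subset,
    (Metric.ball_subset_closedBall.trans hrW).trans hWQ⟩, hrW.trans hWV, hQ', hosc⟩

theorem exists_refine {g : ℝ → ℝ} {M : ℝ} (hg : ∀ x, |g x| ≤ M) (v : DenseBall S) (m : ℕ) :
    ∃ w : Bool → DenseBall S,
      (∀ b, (w b).closedBall ⊆ v.closedBall ∧
        (w b).closedBall ⊆ Metric.closedBall v.center (1 / (m + 1)) ∧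
        (w b).carrier ⊆ v.carrier ∧
        ∀ x ∈ (w b).carrier, ∀ y ∈ (w b).carrier, |g x - g y| ≤ 1 / (m + 1)) ∧
      Disjoint (w true).closedBall (w false).closedBall := by
  have hm : (0 : ℝ) < 1 / (m + 1) := by positivity
  have hv := v.radius_pos
  obtain ⟨ρ, hρ, hρ1, hρ2⟩ : ∃ ρ : ℝ, 0 < ρ ∧ ρ ≤ v.radius ∧ ρ ≤ 1 / (m + 1) :=
    ⟨min v.radius (1 / (m + 1)), lt_min hv hm, min_le_left _ _, min_le_right _ _⟩
  -- The children lie on opposite sides of the centre, hence are disjoint.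
  let V : Bool → Set ℝ := fun b => cond b (Set.Ioo v.center (v.center + ρ))
    (Set.Ioo (v.center - ρ) v.center)
  have hVρ : ∀ b, V b ⊆ Metric.ball v.center ρ := by
    rw [Real.ball_eq_Ioo]
    rintro (_ | _)
    · exact Set.Ioo_subset_Ioo_right (by linarith)
    · exact Set.Ioo_subset_Ioo_left (by linarith)
  have hVo : ∀ b, IsOpen (V b) := by rintro (_ | _) <;> exact isOpen_Ioo
  have hVn : ∀ b, (V b).Nonempty := by
    rintro (_ | _)
    · exact Set.nonempty_Ioo.2 (by linarith)
    · exact Set.nonempty_Ioo.2 (by linarith)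
  choose w hw using fun b => v.exists_refine_in_open hg (hVo b) (hVn b)
    ((hVρ b).trans (Metric.ball_subset_ball hρ1)) hm
  refine ⟨w, fun b => ⟨?_, ?_, (hw b).2⟩, ?_⟩
  · exact ((hw b).1.trans (hVρ b)).trans
      (Metric.ball_subset_closedBall.trans (Metric.closedBall_subset_closedBall hρ1))
  · exact ((hw b).1.trans (hVρ b)).trans
      (Metric.ball_subset_closedBall.trans (Metric.closedBall_subset_closedBall hρ2))
  · refine Set.disjoint_of_subset (hw true).1 (hw false).1 ?_
    rw [Set.disjoint_left]
    intro x hx hx'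
    exact lt_asymm hx.1 hx'.2

end DenseBall

/-! ### The tree and its resting branches -/

/-- A tree of dense balls along which the functions `f n`, `n ∈ A`, are controlled. In step `i`
a branch `z` stays where it is if `z i = none`, and moves to one of two disjoint smaller balls
otherwise. -/
theorem exists_denseBall_tree {S : Set ℝ} (v₀ : DenseBall S) {f : ℕ → ℝ → ℝ}
    (hf : ∀ n, Continuous (f n)) {g : ℝ → ℝ} {M : ℝ} (hg : ∀ x, |g x| ≤ M) {A : Set ℕ}
    (hlim : ∀ x ∈ S, Tendsto (f · x) (atTop ⊓ 𝓟 A) (𝓝 (g x))) :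
    ∃ (F : ℕ → (ℕ → Option Bool) → DenseBall S) (N : ℕ → ℕ), StrictMono N ∧
      (∀ i z z', (∀ j < i, z j = z' j) → F i z = F i z') ∧
      (∀ i z, z i = none → F (i + 1) z = F i z) ∧
      (∀ i z, (F (i + 1) z).closedBall ⊆ (F i z).closedBall ∧
        (F (i + 1) z).carrier ⊆ (F i z).carrier) ∧
      (∀ i z, z i ≠ none →
        (∀ x ∈ (F (i + 1) z).carrier, ∀ y ∈ (F (i + 1) z).carrier,
          |g x - g y| ≤ 1 / ((i : ℝ) + 1)) ∧
        ∀ n < N i, ∀ x ∈ (F (i + 1) z).closedBall,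
          |f n x - f n (F i z).center| ≤ 1 / ((i : ℝ) + 1)) ∧
      (∀ i z z', F i z = F i z' → z i = some true → z' i = some false →
        Disjoint (F (i + 1) z).closedBall (F (i + 1) z').closedBall) ∧
      (∀ i z, ∀ n ∈ A, N i ≤ n →
        |f n (F i z).center - g (F i z).center| ≤ 1 / ((i : ℝ) + 1)) := by
  choose ref href hdisj using fun (v : DenseBall S) (m : ℕ) => v.exists_refine hg m
  -- Finitely many balls per level allow one threshold `N` and one radius for all branches.
  let T := {F : (ℕ → Option Bool) → DenseBall S // (Set.range F).Finite}
  have exN : ∀ (F : T) (i : ℕ), ∃ N, ∀ n ∈ A, N ≤ n → ∀ z,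
      |f n (F.1 z).center - g (F.1 z).center| ≤ 1 / ((i : ℝ) + 1) := by
    intro F i
    have h : ∀ᶠ n in atTop ⊓ 𝓟 A, ∀ v ∈ Set.range F.1,
        |f n v.center - g v.center| ≤ 1 / ((i : ℝ) + 1) := by
      refine (eventually_all_finite F.2).2 fun v _ => ?_
      have := hlim _ (v.carrier_subset v.center_mem)
      have := (Metric.tendsto_nhds.1 this) (1 / ((i : ℝ) + 1)) (by positivity)
      filter_upwards [this] with n hn
      rw [Real.dist_eq] at hn
      exact hn.le
    obtain ⟨N, hN⟩ := eventually_atTop.1 (eventually_inf_principal.1 h)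
    exact ⟨N, fun n hnA hn z => hN n hn hnA _ ⟨z, rfl⟩⟩
  have exm : ∀ (F : T) (N i : ℕ), ∃ m, i ≤ m ∧ ∀ n < N, ∀ z,
      ∀ x ∈ Metric.closedBall (F.1 z).center (1 / ((m : ℝ) + 1)),
        |f n x - f n (F.1 z).center| ≤ 1 / ((i : ℝ) + 1) := by
    intro F N i
    have h : ∀ᶠ m : ℕ in atTop, ∀ n ∈ Set.Iio N, ∀ v ∈ Set.range F.1,
        ∀ x ∈ Metric.closedBall v.center (1 / ((m : ℝ) + 1)),
          |f n x - f n v.center| ≤ 1 / ((i : ℝ) + 1) := by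
      refine (eventually_all_finite (Set.finite_Iio N)).2 fun n _ =>
        (eventually_all_finite F.2).2 fun v _ => ?_
      obtain ⟨δ, hδ, hδf⟩ := Metric.continuous_iff.1 (hf n) v.center (1 / ((i : ℝ) + 1))
        (by positivity)
      filter_upwards [tendsto_one_div_add_atTop_nhds_zero_nat.eventually_lt_const hδ]
        with m hm x hx
      have := hδf x (lt_of_le_of_lt hx hm)
      rw [Real.dist_eq] at this
      exact this.le
    obtain ⟨m, hm, him⟩ := (h.and (eventually_ge_atTop i)).exists
    exact ⟨m, him, fun n hn z => hm n hn _ ⟨z, rfl⟩⟩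
  choose Nof hNof using exN
  choose mof hmof using exm
  let next : T → ℕ → ℕ → T := fun F i m => ⟨fun z => (z i).elim (F.1 z) (ref (F.1 z) m), by
    refine (F.2.biUnion fun v _ => (Set.finite_range (ref v m)).insert v).subset ?_
    rintro _ ⟨z, rfl⟩
    refine Set.mem_biUnion ⟨z, rfl⟩ ?_
    change (z i).elim (F.1 z) (ref (F.1 z) m) ∈ _
    cases z i with
    | none => exact Set.mem_insert _ _
    | some b => exact Set.mem_insert_of_mem _ ⟨b, rfl⟩⟩
  let F₀ : T := ⟨fun _ => v₀, (Set.finite_singleton v₀).subset (by rintro _ ⟨z, rfl⟩; rfl)⟩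
  -- The radius depends on the current `N`; the next `N` is chosen only after the new centres are
  -- known.
  let step : ℕ → T × ℕ → T × ℕ := fun i s =>
    let F' := next s.1 i (mof s.1 s.2 i)
    (F', max (s.2 + 1) (Nof F' (i + 1)))
  let st : ℕ → T × ℕ := fun i => Nat.rec (F₀, Nof F₀ 0) step i
  let m : ℕ → ℕ := fun i => mof (st i).1 (st i).2 i
  have hF : ∀ i z, (st (i + 1)).1.1 z =
      (z i).elim ((st i).1.1 z) (ref ((st i).1.1 z) (m i)) := fun i z => rfl
  have hN : ∀ i, (st (i + 1)).2 = max ((st i).2 + 1) (Nof (st (i + 1)).1 (i + 1)) := fun i => rfl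
  have him : ∀ i, 1 / ((m i : ℝ) + 1) ≤ 1 / ((i : ℝ) + 1) := fun i =>
    one_div_le_one_div_of_le (by positivity) (by
      have : (i : ℝ) ≤ m i := by exact_mod_cast (hmof (st i).1 (st i).2 i).1
      linarith)
  refine ⟨fun i => (st i).1.1, fun i => (st i).2, strictMono_nat_of_lt_succ fun i => ?_, ?_, ?_,
    ?_, ?_, ?_, ?_⟩
  · rw [hN]
    exact lt_of_lt_of_le (Nat.lt_succ_self _) (le_max_left _ _)
  · intro i
    induction i with
    | zero => intro z z' _; rfl
    | succ i ih =>
      intro z z' h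
      change (st (i + 1)).1.1 z = (st (i + 1)).1.1 z'
      rw [hF, hF, h i (Nat.lt_succ_self i)]
      have : (st i).1.1 z = (st i).1.1 z' := ih z z' fun j hj => h j (hj.trans (Nat.lt_succ_self i))
      rw [this]
  · intro i z hz
    change (st (i + 1)).1.1 z = _
    rw [hF, hz]
    rfl
  · intro i z
    change ((st (i + 1)).1.1 z).closedBall ⊆ _ ∧ ((st (i + 1)).1.1 z).carrier ⊆ _
    rw [hF]
    cases z i with
    | none => exact ⟨subset_rfl, subset_rfl⟩
    | some b => exact ⟨(href _ _ b).1, (href _ _ b).2.2.1⟩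
  · intro i z hz
    obtain ⟨b, hb⟩ := Option.ne_none_iff_exists'.1 hz
    have hFb : (st (i + 1)).1.1 z = ref ((st i).1.1 z) (m i) b := by rw [hF, hb]; rfl
    simp only [hFb]
    refine ⟨fun x hx y hy => ((href _ _ b).2.2.2 x hx y hy).trans (him i), fun n hn x hx => ?_⟩
    exact (hmof (st i).1 (st i).2 i).2 n hn z x ((href _ _ b).2.1 hx)
  · intro i z z' h hz hz'
    have h1 : (st (i + 1)).1.1 z = ref ((st i).1.1 z) (m i) true := by rw [hF, hz]; rfl
    have h2 : (st (i + 1)).1.1 z' = ref ((st i).1.1 z) (m i) false := by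
      rw [hF, hz', show (st i).1.1 z = (st i).1.1 z' from h]; rfl
    simp only [h1, h2]
    exact hdisj _ _
  · intro i z n hnA hn
    refine hNof (st i).1 i n hnA (le_trans ?_ hn) z
    cases i with
    | zero => exact le_rfl
    | succ i => exact (le_max_right _ _).trans (hN i).ge

/-- The branch that rests at the steps of parity `b` and follows `w` at the others. -/
def restingBranch (b : Bool) (w : ℕ → Bool) (i : ℕ) : Option Bool :=
  if i.bodd = b then none else some (w (i / 2))

theorem restingBranch_of_bodd_eq {b : Bool} (w : ℕ → Bool) {i : ℕ} (h : i.bodd = b) :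
    restingBranch b w i = none := if_pos h

theorem restingBranch_of_bodd_ne {b : Bool} (w : ℕ → Bool) {i : ℕ} (h : i.bodd ≠ b) :
    restingBranch b w i = some (w (i / 2)) := if_neg h

/-- Two distinct branches that rest at the steps of parity `b` separate at some step. -/
theorem exists_restingBranch_split (b : Bool) {w w' : ℕ → Bool} (h : w ≠ w') :
    ∃ i, (∀ j < i, restingBranch b w j = restingBranch b w' j) ∧
      (restingBranch b w i = some true ∧ restingBranch b w' i = some false ∨
        restingBranch b w i = some false ∧ restingBranch b w' i = some true) := by
  have hex : ∃ i, restingBranch b w i ≠ restingBranch b w' i := by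
    obtain ⟨k, hk⟩ := Function.ne_iff.1 h
    obtain ⟨i, hi, hib⟩ : ∃ i, i / 2 = k ∧ i.bodd ≠ b := by
      cases b
      · exact ⟨2 * k + 1, by omega, by simp⟩
      · exact ⟨2 * k, by omega, by simp⟩
    refine ⟨i, ?_⟩
    rw [restingBranch_of_bodd_ne w hib, restingBranch_of_bodd_ne w' hib, hi]
    simpa using hk
  classical
  refine ⟨Nat.find hex, fun j hj => not_not.1 (Nat.find_min hex hj), ?_⟩
  have hi := Nat.find_spec hex
  generalize Nat.find hex = i at hi
  by_cases hib : i.bodd = b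
  · exact absurd ((restingBranch_of_bodd_eq w hib).trans (restingBranch_of_bodd_eq w' hib).symm) hi
  · rw [restingBranch_of_bodd_ne w hib, restingBranch_of_bodd_ne w' hib] at hi ⊢
    cases h1 : w (i / 2) <;> cases h2 : w' (i / 2) <;> simp_all

/-! ### Uniform convergence on a perfect set -/

/-- Continuous functions that form a uniform Cauchy sequence on an uncountable set converge
uniformly on a nonempty perfect set. -/
theorem exists_perfect_tendstoUniformlyOn {f : ℕ → ℝ → ℝ} (hf : ∀ n, Continuous (f n))
    {l : Filter ℕ} [l.NeBot] {X : Set ℝ} (hX : ¬ X.Countable)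
    (h : ∀ ε > 0, ∀ᶠ p in l ×ˢ l, ∀ x ∈ X, |f p.1 x - f p.2 x| ≤ ε) :
    ∃ P : Set ℝ, Perfect P ∧ P.Nonempty ∧ ∃ g : ℝ → ℝ, TendstoUniformlyOn f g l P := by
  obtain ⟨P, hP, hPne, hPX⟩ := exists_perfect_nonempty_of_isClosed_of_not_countable
    (isClosed_closure (s := X)) fun hc => hX (hc.mono subset_closure)
  have hcau : UniformCauchySeqOn f l P := by
    intro u hu
    obtain ⟨ε, hε, hεu⟩ := Metric.mem_uniformity_dist.1 hu
    filter_upwards [h (ε / 2) (by positivity)] with p hp x hx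
    have hcl : closure X ⊆ {x | |f p.1 x - f p.2 x| ≤ ε / 2} :=
      closure_minimal hp (isClosed_le ((hf _).sub (hf _)).abs continuous_const)
    refine hεu ?_
    rw [Real.dist_eq]
    exact lt_of_le_of_lt (hcl (hPX hx)) (by linarith)
  have hpt : ∀ x, ∃ y, x ∈ P → Tendsto (f · x) l (𝓝 y) := fun x => by
    by_cases hx : x ∈ P
    · obtain ⟨y, hy⟩ := cauchy_map_iff_exists_tendsto.1 (hcau.cauchy_map hx)
      exact ⟨y, fun _ => hy⟩
    · exact ⟨0, fun h => absurd h hx⟩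
  choose g hg using hpt
  exact ⟨P, hP, hPne, g, hcau.tendstoUniformlyOn_of_tendsto hg⟩

/-- If `f n → g` pointwise on a dense set along `A`, then, up to finitely many indices, `A` splits
into two sets along each of which `f` is uniformly Cauchy on some uncountable set. -/
theorem exists_split_uniformCauchy {S : Set ℝ} (hS : Dense S) {f : ℕ → ℝ → ℝ}
    (hf : ∀ n, Continuous (f n)) {g : ℝ → ℝ} {M : ℝ} (hg : ∀ x, |g x| ≤ M) {A : Set ℕ}
    (hlim : ∀ x ∈ S, Tendsto (f · x) (atTop ⊓ 𝓟 A) (𝓝 (g x))) :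
    ∃ (B : Bool → Set ℕ) (X : Bool → Set ℝ), (A \ (B true ∪ B false)).Finite ∧
      ∀ b, ¬ (X b).Countable ∧ ∀ ε > 0, ∀ᶠ p in (atTop ⊓ 𝓟 (B b)) ×ˢ (atTop ⊓ 𝓟 (B b)),
        ∀ x ∈ X b, |f p.1 x - f p.2 x| ≤ ε := by
  obtain ⟨c, hc⟩ := hS.nonempty
  obtain ⟨F, N, hN, hloc, hrest, hsub, hmove, hdisj, hval⟩ := exists_denseBall_tree
    ⟨c, 1, S, one_pos, hc, subset_rfl, by rw [hS.closure_eq]; exact Set.subset_univ _⟩ hf hg hlim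
  have hpt : ∀ z, ∃ x, ∀ i, x ∈ (F i z).closedBall := fun z => by
    obtain ⟨x, hx⟩ := IsCompact.nonempty_iInter_of_sequence_nonempty_isCompact_isClosed
      (fun i => (F i z).closedBall) (fun i => (hsub i z).1)
      (fun i => ⟨_, (F i z).center_mem_closedBall⟩) (isCompact_closedBall _ _)
      (fun i => Metric.isClosed_closedBall)
    exact ⟨x, Set.mem_iInter.1 hx⟩
  choose φ hφ using hpt
  have hanti : ∀ z, Antitone fun i => (F i z).carrier := fun z =>
    antitone_nat_of_succ_le fun i => (hsub i z).2
  refine ⟨fun b => {n ∈ A | ∃ i, i.bodd = b ∧ N i ≤ n ∧ n < N (i + 1)},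
    fun b => Set.range fun w => φ (restingBranch b w), ?_, fun b => ⟨?_, ?_⟩⟩
  · refine (Set.finite_Iio (N 0)).subset fun n hn => ?_
    by_contra hn0
    obtain ⟨hnA, hnB⟩ := hn
    have hex : ∃ i, n < N i := ⟨n + 1, hN.le_apply⟩
    classical
    obtain ⟨i, hi⟩ : ∃ i, Nat.find hex = i + 1 := Nat.exists_eq_succ_of_ne_zero fun h0 => by
      have := Nat.find_spec hex
      rw [h0] at this
      exact hn0 this
    have h1 : n < N (i + 1) := hi ▸ Nat.find_spec hex
    have h2 : N i ≤ n := not_lt.1 (Nat.find_min hex (by omega))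
    refine hnB ?_
    cases hb : i.bodd
    · exact Or.inr ⟨hnA, i, hb, h2, h1⟩
    · exact Or.inl ⟨hnA, i, hb, h2, h1⟩
  · have hinj : Function.Injective fun w => φ (restingBranch b w) := by
      intro w w' hww
      by_contra hne
      obtain ⟨i, hlt, hi⟩ := exists_restingBranch_split b hne
      have hFi := hloc i _ _ hlt
      have hw := hφ (restingBranch b w) (i + 1)
      have hw' := hφ (restingBranch b w') (i + 1)
      rw [← show φ (restingBranch b w) = φ (restingBranch b w') from hww] at hw'
      rcases hi with ⟨h1, h2⟩ | ⟨h1, h2⟩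
      · exact Set.disjoint_left.1 (hdisj i _ _ hFi h1 h2) hw hw'
      · exact Set.disjoint_left.1 (hdisj i _ _ hFi.symm h2 h1) hw' hw
    intro hcount
    have : Uncountable (ℕ → Bool) :=
      Cardinal.aleph0_lt_mk_iff.1 (by simpa using Cardinal.cantor Cardinal.aleph0)
    exact Set.not_countable_univ (Set.countable_of_injective_of_countable_image hinj.injOn
      (Set.image_univ ▸ hcount))
  · intro ε hε
    -- Three errors of `ε / 6` for each of the two indices.
    obtain ⟨K, hK⟩ := exists_nat_one_div_lt (show 0 < ε / 6 by positivity)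
    have key : ∀ᶠ n in atTop ⊓ 𝓟 {n ∈ A | ∃ i, i.bodd = b ∧ N i ≤ n ∧ n < N (i + 1)}, ∀ w,
        |f n (φ (restingBranch b w)) - g (F (K + 2) (restingBranch b w)).center| ≤ ε / 2 := by
      refine eventually_inf_principal.2 ?_
      filter_upwards [eventually_ge_atTop (N (K + 2))] with n hn
      rintro ⟨hnA, i, hib, hi, hi'⟩ w
      set z := restingBranch b w with hz
      have hKi : K + 2 ≤ i := Nat.lt_succ_iff.1 (hN.lt_iff_lt.1 (hn.trans_lt hi'))
      have hKi' : (K : ℝ) + 2 ≤ i := by exact_mod_cast hKi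
      have hmono : ∀ j : ℝ, (K : ℝ) ≤ j → 1 / (j + 1) ≤ ε / 6 := fun j hj =>
        (one_div_le_one_div_of_le (by positivity) (by linarith)).trans hK.le
      have h1 : |f n (φ z) - f n (F i z).center| ≤ ε / 6 := by
        -- Resting at `i` forces a move at `i + 1`, from the unchanged ball `F i z`.
        have hne : z (i + 1) ≠ none := by
          rw [hz, restingBranch_of_bodd_ne w (by rw [Nat.bodd_succ, hib]; cases b <;> simp)]
          exact Option.some_ne_none _
        have := (hmove (i + 1) z hne).2 n hi' (φ z) (hφ z _)
        rw [hrest i z (restingBranch_of_bodd_eq w hib)] at this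
        refine this.trans (hmono _ ?_)
        push_cast
        linarith
      have h2 : |f n (F i z).center - g (F i z).center| ≤ ε / 6 :=
        (hval i z n hnA hi).trans (hmono _ (by linarith))
      have h3 : |g (F i z).center - g (F (K + 2) z).center| ≤ ε / 6 := by
        -- One of the steps `K`, `K + 1` is a move, so by level `K + 2` the oscillation of `g` is
        -- small.
        obtain ⟨j, hj, hj', hjb⟩ : ∃ j, K ≤ j ∧ j + 1 ≤ K + 2 ∧ j.bodd ≠ b := by
          by_cases hKb : K.bodd = b
          · exact ⟨K + 1, by omega, by omega, by rw [Nat.bodd_succ, hKb]; cases b <;> simp⟩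
          · exact ⟨K, le_rfl, by omega, hKb⟩
        have hne : z j ≠ none := by
          rw [hz, restingBranch_of_bodd_ne w hjb]
          exact Option.some_ne_none _
        refine ((hmove j z hne).1 _ (hanti z (hj'.trans hKi) (F i z).center_mem) _
          (hanti z hj' (F (K + 2) z).center_mem)).trans (hmono _ ?_)
        exact_mod_cast hj
      rw [abs_le] at h1 h2 h3 ⊢
      constructor <;> linarith
    filter_upwards [key.prod_mk key] with p hp
    rintro _ ⟨w, rfl⟩
    have h1 := hp.1 w
    have h2 := hp.2 w
    simp only
    rw [abs_le] at h1 h2 ⊢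
    constructor <;> linarith

theorem mainTheorem6 (I : Order.Ideal (Set ℕ)) (hproper : (Set.univ : Set ℕ) ∉ I)
    (hfin : ∀ F : Set ℕ, F.Finite → F ∈ I) :
    HasFinBWProperty I ↔
      ∀ f : ℕ → ℝ → ℝ, (∀ n, Continuous (f n)) → (∃ M : ℝ, ∀ n x, |f n x| ≤ M) →
        ∃ A : Set ℕ, A ∉ I ∧ ∃ P : Set ℝ, Perfect P ∧ P.Nonempty ∧
          ∃ g : ℝ → ℝ, TendstoUniformlyOn f g (atTop ⊓ 𝓟 A) P := by
  constructor
  · rintro h f hf ⟨M, hM⟩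
    obtain ⟨A, hA, g, hg, hlim⟩ :=
      h.exists_tendsto_on_countable hfin (Set.countable_range ((↑) : ℚ → ℝ)) hM
    obtain ⟨B, X, hAB, hBX⟩ :=
      exists_split_uniformCauchy Rat.denseRange_cast hf hg hlim
    obtain ⟨b, hb⟩ : ∃ b, B b ∉ I := by
      by_contra! hB
      refine hA (I.lower ?_ (I.sup_mem (hfin _ hAB) (I.sup_mem (hB true) (hB false))))
      intro n hn
      by_cases hnB : n ∈ B true ∪ B false
      · exact Or.inr hnB
      · exact Or.inl ⟨hn, hnB⟩
    have := Order.Ideal.neBot_atTop_inf_principal hfin hb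
    exact ⟨B b, hb, exists_perfect_tendstoUniformlyOn hf (hBX b).1 (hBX b).2⟩
  · intro h x
    obtain ⟨A, hA, P, -, ⟨t, ht⟩, g, hg⟩ := h (fun n _ => x n) (fun n => continuous_const)
      ⟨1, fun n _ => abs_le.2 ⟨by linarith [(x n).2.1], (x n).2.2⟩⟩
    have := Order.Ideal.neBot_atTop_inf_principal hfin hA
    have hlim := hg.tendsto_at ht
    have hmem : g t ∈ unitInterval :=
      isClosed_Icc.mem_of_tendsto hlim (Eventually.of_forall fun n => (x n).2)
    exact ⟨A, hA, ⟨g t, hmem⟩, tendsto_subtype_rng.2 hlim⟩
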